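/- Let $F$ be a field of characteristic $0$ and let $E$ be the Grassmann algebra of an $F$-vector space $L$ with basis $e_1,e_2,\dots$. A map $\deg$ from $\{e_1,e_2,\dots\}$ to an abelian group $G$ defines a $G$-grading $E=\bigoplus_{g\in G}E_g$ in which $E_g$ is spanned by the monomials $e_{i_1}\cdots e_{i_s}$ with $\deg e_{i_1}+\cdots+\deg e_{i_s}=g$. For positive integers $a,b,k$ let $E_{(-b,0,a)}^{(\infty,k,\infty)}$ be $E$ with a $\mathbb Z$-grading of this kind in which every $e_i$ has degree $-b$, $0$ or $a$, infinitely many $e_i$ have degree $-b$, exactly $k$ have degree $0$, and infinitely many have degree $a$. Let $E_k$ be $E$ with the $\mathbb Z_2$-grading in which $e_1,\dots,e_k$ have degree $0$ and all other $e_i$ have degree $1$, and let $E_\infty$ be $E$ with the $\mathbb Z_2$-grading in which $e_i$ has degree $0$ for even $i$ and degree $1$ for odd $i$. For a group $G$ let $F\langle X|G\rangle$ be the free associative algebra on variables $x_i^{g}$ $(g\in G,\ i\in\mathbb N)$, where $x_i^g$ has degree $g$. For a $G$-graded algebra $A=\bigoplus_{g\in G} A_g$, let $T_G(A)$ be the set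 of its graded identities: the polynomials in $F\langle X|G\rangle$ that vanish whenever each variable of degree $g$ is replaced by an element of $A_g$. The variety defined by a set $S\subseteq F\langle X|G\rangle$ is the class of all $G$-graded algebras $A$ with $S\subseteq T_G(A)$; a member $A$ generates the variety if $T_G(A)$ is equal to the set of the polynomials that are graded identities of all algebras of the variety. Let $\pi_2\colon F\langle X|\mathbb Z\rangle\to F\langle X|\mathbb Z_2\rangle$ be any homomorphism of unital algebras that sends each variable of degree $g$ to a variable of degree $g \bmod 2$ and sends distinct variables to distinct variables. **Theorem.** Let $a,b,k$ be positive integers with $\gcd(a,b)=1$. Then: 1. $E_{(-b,0,a)}^{(\infty,k,\infty)}$ has full support, i.e. for every $g\in\mathbb Z$ its component of degree $g$ is nonzero. 2. If $ab$ is odd, then $E_{(-b,0,a)}^{(\infty,k,\infty)}$ generates the variety of $\mathbb Z$-graded algebras defined by $J=\{f\in F\langle X|\mathbb Z\rangle : \pi_2(f)\in T_{\mathbb Z_2}(E_k)\}$, and $T_{\mathbb Z}\bigl(E_{(-b,0,a)}^{(\infty,k,\infty)}\bigr)=J$. 3. If $ab$ is even, then $E_{(-b,0,a)}^{(\infty,k,\infty)}$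 generates the variety of $\mathbb Z$-graded algebras defined by $J=\{f\in F\langle X|\mathbb Z\rangle : \pi_2(f)\in T_{\mathbb Z_2}(E_\infty)\}$, and $T_{\mathbb Z}\bigl(E_{(-b,0,a)}^{(\infty,k,\infty)}\bigr)=J$. -/

import Mathlib

universe u

open scoped DirectSum

noncomputable section

namespace GrassmannGraded

/-! ## Graded algebras, free graded algebras, graded identities, varieties -/

section Graded

variable {F : Type u} [Field F] {G : Type} {A : Type*} [Ring A] [Algebra F A]

/-- The support of a grading: the degrees whose component is nonzero. -/
def gradedSupport (𝒜 : G → Submodule F A) : Set G := {g | 𝒜 g ≠ ⊥}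

/-- The grading has full support: every degree has a nonzero component. -/
def HasFullSupport (𝒜 : G → Submodule F A) : Prop := gradedSupport 𝒜 = Set.univ

variable (F G) in
/-- The free `G`-graded algebra `F⟨X|G⟩`. The free generator `(g, i)` is the variable of degree `g`
with lower index `i`, so there are countably many variables of each degree. -/
abbrev FreeGraded : Type u := FreeAlgebra F (G × ℕ)

/-- `T_G(A)`: the polynomials of `F⟨X|G⟩` that vanish under each admissible substitution. -/
def gradedIdentities (𝒜 : G → Submodule F A) : Set (FreeGraded F G) :=
  {f | ∀ s : G × ℕ → A, (∀ x, s x ∈ 𝒜 x.1) → FreeAlgebra.lift F s f = 0}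

/-- The graded algebra `A` belongs to the variety defined by the polynomials in `S`. -/
def InVariety [AddMonoid G] [DecidableEq G] (S : Set (FreeGraded F G))
    (𝒜 : G → Submodule F A) [GradedAlgebra 𝒜] : Prop :=
  S ⊆ gradedIdentities 𝒜

/-- The graded identities of the variety of `G`-graded algebras defined by `S`: the polynomials
that are graded identities of each algebra in that variety. -/
def varietyIdentities [AddMonoid G] [DecidableEq G] (S : Set (FreeGraded F G)) :
    Set (FreeGraded F G) :=
  {f | ∀ (C : Type u) [Ring C] [Algebra F C] (𝒞 : G → Submodule F C) [GradedAlgebra 𝒞],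
    InVariety S 𝒞 → f ∈ gradedIdentities 𝒞}

/-- The graded algebra `A` generates the variety of `G`-graded algebras defined by `S`: it belongs
to the variety and has the same graded identities. -/
def GeneratesVariety [AddMonoid G] [DecidableEq G] (𝒜 : G → Submodule F A) [GradedAlgebra 𝒜]
    (S : Set (FreeGraded F G)) : Prop :=
  InVariety S 𝒜 ∧ varietyIdentities S = gradedIdentities 𝒜

end Graded

/-! ## Reduction of degrees modulo `2` -/

/-- A renaming of the variables that replaces degrees in `ℤ` by their classes modulo `2`:
each variable of degree `g` goes to a variable of degree `g` modulo `2`, and different variables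
go to different variables. -/
def IsReduction (τ : ℤ × ℕ → ZMod 2 × ℕ) : Prop :=
  Function.Injective τ ∧ ∀ x, (τ x).1 = (x.1 : ZMod 2)

/-- The homomorphism `π₂ : F⟨X|ℤ⟩ → F⟨X|ℤ₂⟩` given by a renaming of the variables. -/
def piTwo (F : Type u) [Field F] (τ : ℤ × ℕ → ZMod 2 × ℕ) :
    FreeGraded F ℤ →ₐ[F] FreeGraded F (ZMod 2) :=
  FreeAlgebra.lift F (fun x => FreeAlgebra.ι F (τ x))

/-! ## The Grassmann algebra and its homogeneous gradings -/

/-- The Grassmann algebra `E` of the vector space with basis indexed by `ℕ`. -/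
abbrev Grassmann (F : Type u) [Field F] : Type u := ExteriorAlgebra F (ℕ →₀ F)

/-- The generators of `E`; `gen F i` is the `(i+1)`-st generator `e_{i+1}`. -/
def gen (F : Type u) [Field F] (i : ℕ) : Grassmann F :=
  ExteriorAlgebra.ι F (Finsupp.single i 1)

/-- The component of degree `g` of the grading of `E` in which the `i`-th generator has degree
`deg i`: the span of the monomials `e_{i₁} ⋯ e_{iₛ}` with `deg i₁ + ⋯ + deg iₛ = g`. -/
def component (F : Type u) [Field F] {G : Type} [AddCommMonoid G] (deg : ℕ → G) (g : G) :
    Submodule F (Grassmann F) :=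
  Submodule.span F {x | ∃ l : List ℕ, (l.map deg).sum = g ∧ x = (l.map (gen F)).prod}

section Grading

variable (F : Type u) [Field F] {G : Type} [AddCommMonoid G]

theorem gen_mem (deg : ℕ → G) (i : ℕ) : gen F i ∈ component F deg (deg i) :=
  Submodule.subset_span ⟨[i], by simp, by simp⟩

instance component_gradedMonoid (deg : ℕ → G) : SetLike.GradedMonoid (component F deg) where
  one_mem := Submodule.subset_span ⟨[], by simp, by simp⟩
  mul_mem := by
    intro g h x y hx hy
    have := Submodule.mul_mem_mul hx hy
    rw [component, component, Submodule.span_mul_span] at this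
    refine Submodule.span_mono ?_ this
    rintro _ ⟨x, ⟨l, hl, rfl⟩, y, ⟨m, hm, rfl⟩, rfl⟩
    exact ⟨l ++ m, by simp [hl, hm], by simp⟩

theorem gen_mul_gen (i j : ℕ) : gen F i * gen F j + gen F j * gen F i = 0 :=
  ExteriorAlgebra.ι_add_mul_swap _ _

theorem gen_mul_self (i : ℕ) : gen F i * gen F i = 0 :=
  ExteriorAlgebra.ι_sq_zero _

variable [DecidableEq G]

/-- The `i`-th generator as an element of its component. -/
abbrev genC (deg : ℕ → G) (i : ℕ) : component F deg (deg i) := ⟨gen F i, gen_mem F deg i⟩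

/-- The linear map that sends each generator to itself, placed in its component. -/
def toSumAux (deg : ℕ → G) : (ℕ →₀ F) →ₗ[F] ⨁ g, component F deg g :=
  Finsupp.linearCombination F
    (fun i => DirectSum.of (fun g => component F deg g) (deg i) (genC F deg i))

theorem toSumAux_single (deg : ℕ → G) (i : ℕ) (c : F) :
    toSumAux F deg (Finsupp.single i c) =
      c • DirectSum.of (fun g => component F deg g) (deg i) (genC F deg i) := by
  simp [toSumAux]

theorem toSumAux_anticomm (deg : ℕ → G) (m n : ℕ →₀ F) :
    toSumAux F deg m * toSumAux F deg n + toSumAux F deg n * toSumAux F deg m = 0 := by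
  induction m using Finsupp.induction_linear with
  | zero => simp
  | add m m' h h' =>
    rw [map_add, add_mul, mul_add, add_add_add_comm, h, h', add_zero]
  | single i c =>
    induction n using Finsupp.induction_linear with
    | zero => simp
    | add m m' h h' =>
      rw [map_add, add_mul, mul_add, add_add_add_comm, h, h', add_zero]
    | single j d =>
      rw [toSumAux_single, toSumAux_single, smul_mul_smul_comm, smul_mul_smul_comm, mul_comm d c,
        ← smul_add, DirectSum.of_mul_of, DirectSum.of_mul_of]
      have : DirectSum.of (fun g => component F deg g) (deg j + deg i)
          (GradedMonoid.GMul.mul (A := fun g => component F deg g) (genC F deg j) (genC F deg i)) =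
          - DirectSum.of (fun g => component F deg g) (deg i + deg j)
          (GradedMonoid.GMul.mul (A := fun g => component F deg g) (genC F deg i) (genC F deg j)) := by
        rw [← map_neg]
        apply DirectSum.of_eq_of_gradedMonoid_eq
        refine Sigma.subtype_ext (add_comm _ _) ?_
        exact eq_neg_of_add_eq_zero_left (gen_mul_gen F j i)
      rw [this, add_neg_cancel, smul_zero]

theorem toSumAux_sq (deg : ℕ → G) (m : ℕ →₀ F) :
    toSumAux F deg m * toSumAux F deg m = 0 := by
  induction m using Finsupp.induction_linear with
  | zero => simp
  | add m n h h' =>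
    rw [map_add, add_mul, mul_add, mul_add, h, h', zero_add, add_zero, toSumAux_anticomm]
  | single i c =>
    rw [toSumAux_single, smul_mul_smul_comm, DirectSum.of_mul_of]
    have : (GradedMonoid.GMul.mul (A := fun g => component F deg g)
        (genC F deg i) (genC F deg i)) = 0 := by
      apply Subtype.ext
      exact gen_mul_self F i
    rw [this, map_zero, smul_zero]

/-- The algebra homomorphism that splits an element of `E` into its components. -/
def toSum (deg : ℕ → G) : Grassmann F →ₐ[F] ⨁ g, component F deg g :=
  ExteriorAlgebra.lift F ⟨toSumAux F deg, toSumAux_sq F deg⟩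

theorem toSum_gen (deg : ℕ → G) (i : ℕ) : toSum F deg (gen F i) =
    DirectSum.of (fun g => component F deg g) (deg i) (genC F deg i) := by
  have := ExteriorAlgebra.lift_ι_apply F (toSumAux F deg) (toSumAux_sq F deg) (Finsupp.single i 1)
  rw [toSumAux_single, one_smul] at this
  exact this

theorem toSum_monomial (deg : ℕ → G) (l : List ℕ) :
    toSum F deg (l.map (gen F)).prod =
      DirectSum.of (fun g => component F deg g) (l.map deg).sum
        ⟨(l.map (gen F)).prod, Submodule.subset_span ⟨l, rfl, rfl⟩⟩ := by
  induction l with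
  | nil => simp only [List.map_nil, List.prod_nil, map_one]; rfl
  | cons i l ih =>
    have : toSum F deg ((i :: l).map (gen F)).prod =
        toSum F deg (gen F i) * toSum F deg (l.map (gen F)).prod := by
      rw [List.map_cons, List.prod_cons, map_mul]
    rw [this, ih, toSum_gen, DirectSum.of_mul_of]
    rfl

/-- The components of `E` form a grading of the algebra `E`. -/
instance component_gradedAlgebra (deg : ℕ → G) : GradedAlgebra (component F deg) :=
  GradedAlgebra.ofAlgHom _ (toSum F deg)
    (by
      ext i
      change DirectSum.coeAlgHom (component F deg) (toSum F deg (gen F i)) = gen F i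
      rw [toSum_gen, DirectSum.coeAlgHom_of])
    (by
      rintro g ⟨x, hx⟩
      change toSum F deg x = _
      induction hx using Submodule.span_induction with
      | mem x hx =>
        obtain ⟨l, rfl, rfl⟩ := hx
        exact toSum_monomial F deg l
      | zero => rw [map_zero]; exact (map_zero _).symm
      | add x y hx hy h h' => rw [map_add, h, h', ← map_add]; rfl
      | smul c x hx h =>
        rw [map_smul, h]
        exact (map_smul (DirectSum.lof F G (fun g => component F deg g) g) c ⟨x, hx⟩).symm)

end Grading

/-- The degrees `deg` of the generators come from a decomposition of the basis into `n` parts, the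
`j`-th of which consists of `v j` generators of degree `r j`. The corresponding grading of `E` is
the `n`-induced grading with lower indices `r` and upper indices `v`. -/
def IsInduced {G : Type} {n : ℕ} (r : Fin n → G) (v : Fin n → ℕ∞) (deg : ℕ → G) : Prop :=
  Function.Injective r ∧ (∀ i, ∃ j, deg i = r j) ∧ ∀ j, {i | deg i = r j}.encard = v j

/-- Degrees of the generators in the `ℤ₂`-grading `E_k`: the first `k` generators have degree `0`,
the others have degree `1`. -/
def degK (k : ℕ) (i : ℕ) : ZMod 2 := if i < k then 0 else 1

/-- Degrees of the generators in the `ℤ₂`-grading `E_∞`: `e_m` has degree `0` for even `m` and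
degree `1` for odd `m`, where `e_m` is `gen F (m - 1)`. -/
def degInf (i : ℕ) : ZMod 2 := if Even (i + 1) then 0 else 1

/-- The polynomials `f` in `F⟨X|ℤ⟩` with `π₂(f)` in the set `I`. -/
def pullback {F : Type u} [Field F] (τ : ℤ × ℕ → ZMod 2 × ℕ) (I : Set (FreeGraded F (ZMod 2))) :
    Set (FreeGraded F ℤ) :=
  {f | piTwo F τ f ∈ I}

end GrassmannGraded

end

/-! The heart of the matter is that the `ℤ`-graded identities of `E` see degrees only modulo 2.
Since each `ℤ`-component lies in the matching component of the grading reduced modulo 2, identities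
of the latter pull back. For the converse, an element of the reduced component of `g` is a sum of
pieces of degrees `g + 2m`, and these degrees must be corrected to `g`. Coprimality of `a` and `b`
gives even-length monomials of degrees 2 and -2 in arbitrarily late generators; they are central, so
multiplying by powers of sums of them corrects the degrees.

To remove these central factors again, attach powers of an indeterminate `t` to the pieces. Then `f`
becomes a polynomial in `t` over `E` that vanishes at all central elements of the chosen degree. A
sum `c` of `N` disjoint even monomials satisfies `c ^ (N + 1) = 0`, while `c ^ N` is `N!` times
their product, which in characteristic 0 annihilates no nonzero element in earlier generators. Hence
the polynomial is zero (`eq_zero_of_eval_central`), and `t = 1` recovers the original substitution.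

Finally, graded identities depend only on how many generators have each degree, and counting modulo
2 gives `E_k` or `E_∞`. The claim about varieties is then formal, because `J` is the identity set of
`E` itself. -/

namespace GrassmannGraded

variable {F : Type u} [Field F]

/-! ## Products of generators -/

/-- The subalgebra of `E` generated by the generators with index in `S`. -/
noncomputable def genAlgebra (F : Type u) [Field F] (S : Set ℕ) : Subalgebra F (Grassmann F) :=
  Algebra.adjoin F (gen F '' S)

theorem genAlgebra_mono {S T : Set ℕ} (h : S ⊆ T) : genAlgebra F S ≤ genAlgebra F T :=
  Algebra.adjoin_mono (Set.image_mono h)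

theorem gen_mem_genAlgebra {S : Set ℕ} {i : ℕ} (hi : i ∈ S) : gen F i ∈ genAlgebra F S :=
  Algebra.subset_adjoin (Set.mem_image_of_mem _ hi)

theorem prod_gen_mem_genAlgebra {S : Set ℕ} {l : List ℕ} (hl : ∀ i ∈ l, i ∈ S) :
    (l.map (gen F)).prod ∈ genAlgebra F S := by
  refine list_prod_mem fun x hx => ?_
  obtain ⟨i, hi, rfl⟩ := List.mem_map.1 hx
  exact gen_mem_genAlgebra (hl i hi)

theorem exists_mem_genAlgebra (x : Grassmann F) : ∃ M, x ∈ genAlgebra F (Set.Iio M) := by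
  induction x using ExteriorAlgebra.induction with
  | algebraMap r => exact ⟨0, Subalgebra.algebraMap_mem _ r⟩
  | ι m =>
    induction m using Finsupp.induction_linear with
    | zero => exact ⟨0, by rw [map_zero]; exact zero_mem _⟩
    | add m n hm hn =>
      obtain ⟨M, hM⟩ := hm
      obtain ⟨N, hN⟩ := hn
      refine ⟨max M N, ?_⟩
      rw [map_add]
      exact add_mem (genAlgebra_mono (Set.Iio_subset_Iio (le_max_left _ _)) hM)
        (genAlgebra_mono (Set.Iio_subset_Iio (le_max_right _ _)) hN)
    | single i c =>
      refine ⟨i + 1, ?_⟩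
      rw [← Finsupp.smul_single_one, map_smul]
      exact Subalgebra.smul_mem _ (gen_mem_genAlgebra (Set.mem_Iio.2 i.lt_succ_self)) c
  | mul x y hx hy =>
    obtain ⟨M, hM⟩ := hx
    obtain ⟨N, hN⟩ := hy
    exact ⟨max M N, mul_mem (genAlgebra_mono (Set.Iio_subset_Iio (le_max_left _ _)) hM)
      (genAlgebra_mono (Set.Iio_subset_Iio (le_max_right _ _)) hN)⟩
  | add x y hx hy =>
    obtain ⟨M, hM⟩ := hx
    obtain ⟨N, hN⟩ := hy
    exact ⟨max M N, add_mem (genAlgebra_mono (Set.Iio_subset_Iio (le_max_left _ _)) hM)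
      (genAlgebra_mono (Set.Iio_subset_Iio (le_max_right _ _)) hN)⟩

theorem contractLeft_eq_zero {S : Set ℕ} {d : Module.Dual F (ℕ →₀ F)}
    (hd : ∀ i ∈ S, d (Finsupp.single i 1) = 0) {p : Grassmann F} (hp : p ∈ genAlgebra F S) :
    CliffordAlgebra.contractLeft d p = 0 := by
  rw [genAlgebra, ← Subalgebra.mem_toSubmodule, Algebra.adjoin_eq_span] at hp
  induction hp using Submodule.span_induction with
  | mem x hx =>
    induction hx using Submonoid.closure_induction_left with
    | one => exact CliffordAlgebra.contractLeft_one _ _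
    | mul_left x hx y hy ih =>
      obtain ⟨i, hi, rfl⟩ := hx
      have := CliffordAlgebra.contractLeft_ι_mul (Q := (0 : QuadraticForm F (ℕ →₀ F)))
        d (Finsupp.single i 1) y
      rw [ih, hd i hi, zero_smul, mul_zero, sub_zero] at this
      exact this
  | zero => exact map_zero _
  | add x y _ _ hx hy => rw [map_add, hx, hy, add_zero]
  | smul c x _ hx => rw [map_smul, hx, smul_zero]

/-- Contraction with the `i`-th coordinate kills `p`, which does not involve `gen F i`, so it sends
`gen F i * p` back to `p`. -/
theorem eq_zero_of_gen_mul_eq_zero {S : Set ℕ} {i : ℕ} (hi : i ∉ S) {p : Grassmann F}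
    (hp : p ∈ genAlgebra F S) (h : gen F i * p = 0) : p = 0 := by
  have h1 := CliffordAlgebra.contractLeft_ι_mul (Q := (0 : QuadraticForm F (ℕ →₀ F)))
    (Finsupp.lapply i) (Finsupp.single i 1) p
  rw [contractLeft_eq_zero (S := S) (fun j hj => by
    simp [show j ≠ i from fun e => hi (e ▸ hj)]) hp] at h1
  change CliffordAlgebra.contractLeft (Finsupp.lapply i) (gen F i * p) = _ at h1
  rw [h] at h1
  simpa using h1.symm

theorem eq_zero_of_prod_gen_mul_eq_zero {l : List ℕ} (hl : l.Nodup) {S : Set ℕ}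
    (hS : ∀ i ∈ l, i ∉ S) {p : Grassmann F} (hp : p ∈ genAlgebra F S)
    (h : (l.map (gen F)).prod * p = 0) : p = 0 := by
  induction l with
  | nil => simpa using h
  | cons i l ih =>
    rw [List.nodup_cons] at hl
    refine ih hl.2 (fun j hj => hS j (List.mem_cons_of_mem _ hj)) ?_
    rw [List.map_cons, List.prod_cons, mul_assoc] at h
    refine eq_zero_of_gen_mul_eq_zero (S := S ∪ {j | j ∈ l}) ?_ ?_ h
    · rintro (h' | h')
      exacts [hS i List.mem_cons_self h', hl.1 h']
    · exact mul_mem (prod_gen_mem_genAlgebra fun j hj => Or.inr hj)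
        (genAlgebra_mono Set.subset_union_left hp)

theorem prod_gen_ne_zero {l : List ℕ} (hl : l.Nodup) : (l.map (gen F)).prod ≠ 0 := fun h =>
  one_ne_zero (α := Grassmann F) <| eq_zero_of_prod_gen_mul_eq_zero hl (S := ∅)
    (fun _ _ => Set.notMem_empty _) (one_mem _) (by rw [h, zero_mul])

theorem prod_gen_mul_ι (l : List ℕ) (m : ℕ →₀ F) :
    (l.map (gen F)).prod * ExteriorAlgebra.ι F m =
      (-1) ^ l.length * (ExteriorAlgebra.ι F m * (l.map (gen F)).prod) := by
  induction l with
  | nil => simp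
  | cons i l ih =>
    have h : gen F i * ExteriorAlgebra.ι F m = -(ExteriorAlgebra.ι F m * gen F i) :=
      eq_neg_of_add_eq_zero_left (ExteriorAlgebra.ι_add_mul_swap _ _)
    have h' : gen F i * (-1) ^ l.length = (-1) ^ l.length * gen F i :=
      ((Commute.neg_one_right _).pow_right _).eq
    rw [List.map_cons, List.prod_cons, mul_assoc, ih, ← mul_assoc, h', mul_assoc,
      ← mul_assoc (gen F i), h, List.length_cons, pow_succ]
    simp [mul_assoc]

theorem prod_gen_commute {l : List ℕ} (hl : Even l.length) (x : Grassmann F) :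
    Commute (l.map (gen F)).prod x := by
  induction x using ExteriorAlgebra.induction with
  | algebraMap r => exact (Algebra.commutes r _).symm
  | ι m => exact (prod_gen_mul_ι l m).trans (by rw [hl.neg_one_pow, one_mul])
  | mul x y hx hy => exact hx.mul_right hy
  | add x y hx hy => exact hx.add_right hy

/-- By centrality the first generator of the second factor can be moved next to that of the first,
where it squares to zero. -/
theorem prod_gen_mul_self {l : List ℕ} (hl : Even l.length) (h0 : l ≠ []) :
    (l.map (gen F)).prod * (l.map (gen F)).prod = 0 := by
  cases l with
  | nil => exact absurd rfl h0
  | cons i l =>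
    have h := (prod_gen_commute hl (gen F i)).eq
    calc ((i :: l).map (gen F)).prod * ((i :: l).map (gen F)).prod
        = ((i :: l).map (gen F)).prod * gen F i * (l.map (gen F)).prod := by
          rw [mul_assoc]; exact congrArg _ List.prod_cons
      _ = gen F i * gen F i * (l.map (gen F)).prod * (l.map (gen F)).prod := by
          rw [h, List.map_cons, List.prod_cons, ← mul_assoc]
      _ = 0 := by rw [gen_mul_self, zero_mul, zero_mul]

theorem add_pow_succ_of_mul_self_eq_zero {R : Type*} [Ring R] {c d : R}
    (h : Commute c d) (hd : d * d = 0) (n : ℕ) :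
    (c + d) ^ (n + 1) = c ^ (n + 1) + (n + 1 : ℕ) • (d * c ^ n) := by
  induction n with
  | zero => simp
  | succ n ih =>
    have h1 : d * c ^ n * d = 0 := by
      rw [mul_assoc, (h.pow_left n).eq, ← mul_assoc, hd, zero_mul]
    rw [pow_succ, ih, add_mul, mul_add, mul_add, smul_mul_assoc, smul_mul_assoc, h1,
      (h.pow_left _).eq, smul_zero, mul_assoc, ← pow_succ, ← pow_succ, add_zero, add_assoc]
    congr 1
    rw [add_comm, ← succ_nsmul]

/-- `E` has arbitrarily late nonzero even monomials of degree `h`. -/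
def HasEvenMonomials (deg : ℕ → ℤ) (h : ℤ) : Prop :=
  ∀ M, ∃ l : List ℕ, l.Nodup ∧ (∀ i ∈ l, M ≤ i) ∧ Even l.length ∧ l ≠ [] ∧ (l.map deg).sum = h

/-- The element is a sum of `N` even monomials in disjoint sets of generators beyond `M`.
Characteristic 0 keeps the factor `N!` in `c ^ N` invertible. -/
theorem exists_central [CharZero F] {deg : ℕ → ℤ} {h : ℤ} (H : HasEvenMonomials deg h) (M N : ℕ) :
    ∃ c : Grassmann F, (∀ x, Commute c x) ∧ c ∈ component F deg h ∧ c ^ (N + 1) = 0 ∧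
      ∀ p ∈ genAlgebra F (Set.Iio M), c ^ N * p = 0 → p = 0 := by
  induction N with
  -- The empty sum works because `0 ^ 0 = 1`.
  | zero => exact ⟨0, fun x => Commute.zero_left x, zero_mem _, by simp, fun p _ => by simp⟩
  | succ N ih =>
    obtain ⟨c, hc, hcm, hc0, hcp⟩ := ih
    obtain ⟨M', hM'⟩ := exists_mem_genAlgebra c
    -- The new monomial avoids the generators of both `p` and `c`, so it can be cancelled from `d *
    -- c ^ N * p = 0`.
    obtain ⟨l, hl, hlM, hev, hne, hsum⟩ := H (max M M')
    have hdd := prod_gen_mul_self (F := F) hev hne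
    refine ⟨c + (l.map (gen F)).prod, fun x => (hc x).add_left (prod_gen_commute hev x),
      add_mem hcm (Submodule.subset_span ⟨l, hsum, rfl⟩), ?_, fun p hp h0 => ?_⟩
    · rw [add_pow_succ_of_mul_self_eq_zero (hc _) hdd, pow_succ, hc0]
      simp
    · rw [add_pow_succ_of_mul_self_eq_zero (hc _) hdd, hc0, zero_add, smul_mul_assoc,
        ← Nat.cast_smul_eq_nsmul F, smul_eq_zero_iff_right (Nat.cast_ne_zero.2 N.succ_ne_zero),
        mul_assoc] at h0
      refine hcp p hp (eq_zero_of_prod_gen_mul_eq_zero hl (S := Set.Iio (max M M')) ?_ ?_ h0)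
      · exact fun i hi => not_lt.2 (hlM i hi)
      · exact mul_mem (pow_mem (genAlgebra_mono (Set.Iio_subset_Iio (le_max_right _ _)) hM') _)
          (genAlgebra_mono (Set.Iio_subset_Iio (le_max_left _ _)) hp)

/-! ## Passing from central substitutions to `1` -/

-- With `N` the degree of `P` and `j` its trailing degree, multiplying `P.eval c = 0` by `c ^ (N -
-- j)` kills all terms above `j`, as `c ^ (N + 1) = 0`. What remains is `c ^ N` times the trailing
-- coefficient, so that coefficient would vanish.
open Polynomial in
theorem eq_zero_of_eval_central [CharZero F] {deg : ℕ → ℤ} {h : ℤ} (H : HasEvenMonomials deg h)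
    (P : (Grassmann F)[X])
    (hP : ∀ c ∈ component F deg h, (∀ x, Commute c x) → P.eval c = 0) : P = 0 := by
  by_contra hne
  have hM : ∃ M, ∀ n, P.coeff n ∈ genAlgebra F (Set.Iio M) := by
    choose M hM using fun n => exists_mem_genAlgebra (P.coeff n)
    refine ⟨P.support.sup M, fun n => ?_⟩
    by_cases hn : n ∈ P.support
    · exact genAlgebra_mono (Set.Iio_subset_Iio (Finset.le_sup hn)) (hM n)
    · rw [notMem_support_iff.1 hn]
      exact zero_mem _
  obtain ⟨M, hM⟩ := hM
  obtain ⟨c, hc, hcm, hc0, hcp⟩ := exists_central (F := F) H M P.natDegree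
  have ht := natTrailingDegree_le_natDegree P
  apply trailingCoeff_nonzero_iff_nonzero.2 hne
  apply hcp _ (hM _)
  have h0 := hP c hcm hc
  rw [eval_eq_sum_range] at h0
  have h1 := congrArg (c ^ (P.natDegree - P.natTrailingDegree) * ·) h0
  simp only [mul_zero, Finset.mul_sum] at h1
  rw [Finset.sum_eq_single P.natTrailingDegree] at h1
  · rw [← mul_assoc, mul_assoc, ((hc _).pow_left P.natTrailingDegree).symm.eq, ← mul_assoc,
      ← pow_add, Nat.sub_add_cancel ht] at h1
    exact h1
  · intro n _ hn
    rcases lt_or_gt_of_ne hn with hn | hn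
    · rw [coeff_eq_zero_of_lt_natTrailingDegree hn]
      simp
    · rw [((hc _).pow_left n).symm.eq, ← mul_assoc, ← pow_add,
        pow_eq_zero_of_le (by omega) hc0, zero_mul]
  · intro hn
    exact absurd (Finset.mem_range.2 (Nat.lt_succ_of_le ht)) hn

open Polynomial in
/-- Evaluation of polynomials at a central element. -/
noncomputable def evalCentral (c : Grassmann F) (hc : ∀ x, Commute c x) : (Grassmann F)[X] →ₐ[F] Grassmann F :=
  { eval₂RingHom' (RingHom.id _) c (fun x => (hc x).symm) with
    commutes' := fun r => by
      change eval₂ (RingHom.id _) c (algebraMap F (Grassmann F)[X] r) = _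
      rw [Polynomial.algebraMap_apply, eval₂_C]
      rfl }

open Polynomial in
theorem evalCentral_apply (c : Grassmann F) (hc : ∀ x, Commute c x) (P : (Grassmann F)[X]) :
    evalCentral c hc P = P.eval c := rfl

open Polynomial in
theorem evalCentral_lift {ι : Type*} (c : Grassmann F) (hc : ∀ x, Commute c x)
    (s : ι → (Grassmann F)[X]) (f : FreeAlgebra F ι) :
    (FreeAlgebra.lift F s f).eval c = FreeAlgebra.lift F (fun x => (s x).eval c) f := by
  rw [← evalCentral_apply c hc, ← AlgHom.comp_apply]
  congr 1
  ext x
  simp [evalCentral_apply]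

open Polynomial in
/-- If `f` vanishes on all substitutions from `W`, it vanishes on all substitutions from `V`,
provided that the elements of `V` are the values at `1` of polynomials that take values in `W`
at the central elements of degree `h`. -/
theorem lift_eq_zero_of_central [CharZero F] {deg : ℕ → ℤ} {h : ℤ} (H : HasEvenMonomials deg h)
    {ι : Type*} {V W : ι → Submodule F (Grassmann F)}
    (hVW : ∀ x, ∀ v ∈ V x, ∃ q : (Grassmann F)[X], q.eval 1 = v ∧
      ∀ c ∈ component F deg h, q.eval c ∈ W x)
    {f : FreeAlgebra F ι} (hf : ∀ s : ι → Grassmann F, (∀ x, s x ∈ W x) → FreeAlgebra.lift F s f = 0)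
    (s : ι → Grassmann F) (hs : ∀ x, s x ∈ V x) : FreeAlgebra.lift F s f = 0 := by
  choose q hq1 hqc using fun x => hVW x (s x) (hs x)
  -- Evaluating `f` in polynomials over `E` treats all central `c` at once; the vanishing then
  -- transfers to the value at 1, whose degree is not `h`.
  have h0 : FreeAlgebra.lift F q f = 0 := eq_zero_of_eval_central H _ fun c hcm hc => by
    rw [evalCentral_lift c hc]
    exact hf _ fun x => hqc x c hcm
  have h1 := evalCentral_lift 1 Commute.one_left q f
  rw [h0, eval_zero] at h1
  simpa only [hq1] using h1.symm

-- Each piece `v` of `V i` is replaced by `v * t ^ n`, with `n` the power that corrects its degree.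
open Polynomial in
theorem exists_polynomial_of_mem_iSup {deg : ℕ → ℤ} {h : ℤ} {ι : Type*}
    {V : ι → Submodule F (Grassmann F)} {W : Submodule F (Grassmann F)}
    (hVW : ∀ i, ∃ n : ℕ, ∀ v ∈ V i, ∀ c ∈ component F deg h, v * c ^ n ∈ W)
    (v : Grassmann F) (hv : v ∈ ⨆ i, V i) :
    ∃ q : (Grassmann F)[X], q.eval 1 = v ∧ ∀ c ∈ component F deg h, q.eval c ∈ W := by
  refine Submodule.iSup_induction V (motive := fun v => ∃ q : (Grassmann F)[X], q.eval 1 = v ∧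
    ∀ c ∈ component F deg h, q.eval c ∈ W) hv (fun i v hv => ?_) ⟨0, by simp, fun c _ => by simp⟩
    fun x y hx hy => ?_
  · obtain ⟨n, hn⟩ := hVW i
    exact ⟨monomial n v, by simp, fun c hc => by simpa using hn v hv c hc⟩
  · obtain ⟨q, hq, hqc⟩ := hx
    obtain ⟨r, hr, hrc⟩ := hy
    exact ⟨q + r, by simp [hq, hr], fun c hc => by simpa using add_mem (hqc c hc) (hrc c hc)⟩

theorem component_pow_mem {deg : ℕ → ℤ} {g h : ℤ} {v c : Grassmann F} (hv : v ∈ component F deg g)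
    (hc : c ∈ component F deg h) (n : ℕ) : v * c ^ n ∈ component F deg (g + n * h) := by
  have := SetLike.mul_mem_graded hv (SetLike.pow_mem_graded n hc)
  rwa [nsmul_eq_mul] at this

theorem component_mod_two_le (deg : ℕ → ℤ) (g : ℤ) :
    component F (fun i => (deg i : ZMod 2)) (g : ZMod 2) ≤
      ⨆ m : ℤ, component F deg (g + 2 * m) := by
  refine Submodule.span_le.2 ?_
  rintro _ ⟨l, hl, rfl⟩
  have h1 : (((l.map deg).sum - g : ℤ) : ZMod 2) = 0 := by
    rw [Int.cast_sub, ← hl, Int.cast_list_sum, List.map_map, sub_eq_zero]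
    rfl
  obtain ⟨m, hm⟩ := (ZMod.intCast_zmod_eq_zero_iff_dvd _ 2).1 h1
  exact Submodule.mem_iSup_of_mem m (Submodule.subset_span ⟨l, by push_cast at hm; linarith, rfl⟩)

theorem component_le_mod_two (deg : ℕ → ℤ) (g : ℤ) :
    component F deg g ≤ component F (fun i => (deg i : ZMod 2)) (g : ZMod 2) := by
  refine Submodule.span_mono ?_
  rintro _ ⟨l, rfl, rfl⟩
  exact ⟨l, by rw [Int.cast_list_sum, List.map_map]; rfl, rfl⟩

theorem lift_eq_zero_of_mod_two [CharZero F] {deg : ℕ → ℤ} (H : HasEvenMonomials deg 2)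
    (H' : HasEvenMonomials deg (-2)) {f : FreeGraded F ℤ}
    (hf : f ∈ gradedIdentities (component F deg)) (s : ℤ × ℕ → Grassmann F)
    (hs : ∀ x, s x ∈ component F (fun i => (deg i : ZMod 2)) (x.1 : ZMod 2)) :
    FreeAlgebra.lift F s f = 0 := by
  -- Only nonnegative powers are available, so there are two passes: factors of degree -2 bring
  -- every piece to a degree `g - 2n` with `n ≥ 0`, then factors of degree 2 raise it to exactly
  -- `g`.
  refine lift_eq_zero_of_central H'
    (V := fun x : ℤ × ℕ => ⨆ m : ℤ, component F deg (x.1 + 2 * m))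
    (W := fun x : ℤ × ℕ => ⨆ n : ℕ, component F deg (x.1 - 2 * n))
    (fun x => exists_polynomial_of_mem_iSup fun m => ⟨m.toNat, fun v hv c hc => ?_⟩)
    (lift_eq_zero_of_central H
      (fun x => exists_polynomial_of_mem_iSup fun n => ⟨n, fun v hv c hc => ?_⟩) hf)
    s fun x => component_mod_two_le deg x.1 (hs x)
  · refine Submodule.mem_iSup_of_mem (-m).toNat ?_
    convert component_pow_mem hv hc m.toNat using 2
    have := Int.toNat_sub_toNat_neg m
    linarith
  · convert component_pow_mem hv hc n using 2
    ring

theorem gradedIdentities_eq_pullback [CharZero F] {deg : ℕ → ℤ} (H : HasEvenMonomials deg 2)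
    (H' : HasEvenMonomials deg (-2)) {τ : ℤ × ℕ → ZMod 2 × ℕ} (hτ : IsReduction τ) :
    gradedIdentities (component F deg) =
      pullback τ (gradedIdentities (component F fun i => (deg i : ZMod 2))) := by
  have key : ∀ (t : ZMod 2 × ℕ → Grassmann F) (f : FreeGraded F ℤ),
      FreeAlgebra.lift F t (piTwo F τ f) = FreeAlgebra.lift F (t ∘ τ) f := by
    intro t f
    rw [← AlgHom.comp_apply]
    congr 1
    ext x
    simp [piTwo]
  ext f
  constructor
  · intro hf t ht
    rw [key]
    refine lift_eq_zero_of_mod_two H H' hf _ fun x => ?_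
    rw [← hτ.2 x]
    exact ht _
  · intro hf s hs
    -- Variables outside the range of `τ` do not occur in `piTwo F τ f`, so they may be sent to 0.
    have := hf (Function.extend τ s 0) fun y => by
      by_cases hy : ∃ x, τ x = y
      · obtain ⟨x, rfl⟩ := hy
        rw [hτ.1.extend_apply, hτ.2 x]
        exact component_le_mod_two deg x.1 (hs x)
      · rw [Function.extend_apply' _ _ _ hy]
        exact zero_mem _
    rw [key] at this
    rwa [show Function.extend τ s 0 ∘ τ = s from funext fun x => hτ.1.extend_apply _ _ _] at this

/-! ## Renaming the generators -/

/-- A degree-preserving injection of generators induces an injective graded endomorphism of `E`, so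
identities restrict along it. -/
theorem gradedIdentities_subset_of_injective {G : Type} [AddCommMonoid G] {d d' : ℕ → G}
    {σ : ℕ → ℕ} (hσ : Function.Injective σ) (h : ∀ i, d' (σ i) = d i) :
    gradedIdentities (component F d') ⊆ gradedIdentities (component F d) := by
  intro f hf s hs
  let φ : Grassmann F →ₐ[F] Grassmann F := ExteriorAlgebra.map (Finsupp.lmapDomain F F σ)
  have hφ : Function.Injective φ := ExteriorAlgebra.map_injective_field
    (LinearMap.ker_eq_bot.2 (Finsupp.mapDomain_injective hσ))
  have hgen : ∀ i, φ (gen F i) = gen F (σ i) := fun i => by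
    simp [φ, gen]
  have hcomp : ∀ g, ∀ x ∈ component F d g, φ x ∈ component F d' g := by
    intro g x hx
    suffices component F d g ≤ (component F d' g).comap φ.toLinearMap from this hx
    refine Submodule.span_le.2 ?_
    rintro _ ⟨l, rfl, rfl⟩
    refine Submodule.subset_span ⟨l.map σ, ?_, ?_⟩
    · rw [List.map_map]
      congr 2
      exact funext h
    · change φ _ = _
      rw [map_list_prod, List.map_map, List.map_map]
      congr 2
      exact funext hgen
  have h1 := hf (fun x => φ (s x)) fun x => hcomp _ _ (hs x)
  apply hφ
  rw [map_zero, ← h1, ← AlgHom.comp_apply]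
  congr 1
  ext x
  simp

theorem nonempty_equiv_of_encard_eq {s t : Set ℕ} (h : s.encard = t.encard) :
    Nonempty (s ≃ t) := by
  by_cases hs : s.Finite
  · have ht : t.Finite := Set.encard_ne_top_iff.1 (h ▸ Set.encard_ne_top_iff.2 hs)
    have := hs.to_subtype
    have := ht.to_subtype
    rw [← Finite.card_eq, Nat.card_coe_set_eq, Nat.card_coe_set_eq, Set.ncard, Set.ncard, h]
  · have ht : t.Infinite := Set.encard_eq_top_iff.1 (h ▸ Set.encard_eq_top_iff.2 hs)
    have := Set.Infinite.to_subtype hs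
    have := ht.to_subtype
    exact nonempty_equiv_of_countable

theorem gradedIdentities_eq_of_encard_eq {G : Type} [AddCommMonoid G] {d d' : ℕ → G}
    (h : ∀ g, {i | d i = g}.encard = {i | d' i = g}.encard) :
    gradedIdentities (component F d) = gradedIdentities (component F d') := by
  let e : ∀ g, {i // d i = g} ≃ {i // d' i = g} := fun g =>
    (nonempty_equiv_of_encard_eq (h g)).some
  have he : ∀ i, d' (Equiv.ofFiberEquiv e i) = d i := Equiv.ofFiberEquiv_map e
  refine Set.Subset.antisymm
    (gradedIdentities_subset_of_injective (Equiv.ofFiberEquiv e).symm.injective fun i => ?_)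
    (gradedIdentities_subset_of_injective (Equiv.ofFiberEquiv e).injective he)
  rw [← he, Equiv.apply_symm_apply]

theorem generatesVariety_gradedIdentities {G : Type} [AddCommMonoid G] [DecidableEq G]
    (d : ℕ → G) :
    GeneratesVariety (component F d) (gradedIdentities (component F d)) :=
  ⟨subset_rfl, Set.Subset.antisymm (fun _ hf => hf _ (component F d) subset_rfl)
    fun _ hf _ _ _ _ _ h𝒞 => h𝒞 hf⟩

/-! ## Monomials of given degree -/

theorem exists_monomial {deg : ℕ → ℤ} {a b : ℕ} (ha : 0 < a)
    (hA : {i | deg i = a}.Infinite) (hB : {i | deg i = -(b : ℤ)}.Infinite) (M u v : ℕ) :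
    ∃ l : List ℕ, l.Nodup ∧ (∀ i ∈ l, M ≤ i) ∧ l.length = u + v ∧
      (l.map deg).sum = u * a - v * b := by
  obtain ⟨s, hs, hsc⟩ := (hA.sdiff (Set.finite_Iio M)).exists_subset_card_eq u
  obtain ⟨t, ht, htc⟩ := (hB.sdiff (Set.finite_Iio M)).exists_subset_card_eq v
  have hst : Disjoint s t := Finset.disjoint_left.2 fun i hi hi' => by
    have h1 : deg i = a := (hs hi).1
    have h2 : deg i = -(b : ℤ) := (ht hi').1
    omega
  refine ⟨(s ∪ t).toList, Finset.nodup_toList _, fun i hi => ?_, ?_, ?_⟩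
  · rw [Finset.mem_toList, Finset.mem_union] at hi
    rcases hi with hi | hi
    exacts [not_lt.1 (hs hi).2, not_lt.1 (ht hi).2]
  · rw [Finset.length_toList, Finset.card_union_of_disjoint hst, hsc, htc]
  · rw [Finset.sum_map_toList, Finset.sum_union hst, Finset.sum_congr rfl fun i hi => (hs hi).1,
      Finset.sum_congr rfl fun i hi => (ht hi).1]
    simp [hsc, htc, sub_eq_add_neg]

theorem exists_combination {a b : ℕ} (ha : 0 < a) (hb : 0 < b) (hab : Nat.gcd a b = 1) (g : ℤ) :
    ∃ u v : ℕ, 0 < u ∧ (u * a - v * b : ℤ) = g := by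
  have h1 : (a * Nat.gcdA a b + b * Nat.gcdB a b : ℤ) = 1 := by
    rw [← Nat.gcd_eq_gcd_ab, hab, Nat.cast_one]
  set x := Nat.gcdA a b
  set y := Nat.gcdB a b
  have ha' : (1 : ℤ) ≤ a := by exact_mod_cast ha
  have hb' : (1 : ℤ) ≤ b := by exact_mod_cast hb
  obtain ⟨u, hu⟩ := Int.eq_ofNat_of_zero_le
    -- A Bézout solution shifted by a large multiple of `(b, a)`, which leaves the combination
    -- unchanged; the `+ 1` makes `u` strictly positive.
    (show 0 ≤ g * x + b * (|g * x| + |g * y| + 1) by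
      nlinarith [neg_abs_le (g * x), abs_nonneg (g * x), abs_nonneg (g * y)])
  obtain ⟨v, hv⟩ := Int.eq_ofNat_of_zero_le
    (show 0 ≤ -(g * y) + a * (|g * x| + |g * y| + 1) by
      nlinarith [le_abs_self (g * y), abs_nonneg (g * x), abs_nonneg (g * y)])
  refine ⟨u, v, ?_, ?_⟩
  · have : (0 : ℤ) < u := by
      rw [← hu]
      nlinarith [neg_abs_le (g * x), abs_nonneg (g * x), abs_nonneg (g * y)]
    exact_mod_cast this
  · rw [← hu, ← hv]
    linear_combination g * h1

/-- Doubling the numbers of generators in a combination of degree `g` makes the length even and the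
degree `2 * g`; `0 < u` keeps the monomial nonempty. -/
theorem hasEvenMonomials_two_mul {deg : ℕ → ℤ} {a b : ℕ} (ha : 0 < a) (hb : 0 < b)
    (hab : Nat.gcd a b = 1) (hA : {i | deg i = a}.Infinite) (hB : {i | deg i = -(b : ℤ)}.Infinite)
    (g : ℤ) : HasEvenMonomials deg (2 * g) := by
  intro M
  obtain ⟨u, v, hu, huv⟩ := exists_combination ha hb hab g
  obtain ⟨l, h1, h2, h3, h4⟩ := exists_monomial ha hA hB M (2 * u) (2 * v)
  refine ⟨l, h1, h2, ⟨u + v, by omega⟩, fun h => ?_, ?_⟩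
  · rw [h, List.length_nil] at h3
    omega
  · rw [h4, ← huv]
    push_cast
    ring

theorem hasFullSupport_component {deg : ℕ → ℤ} {a b : ℕ} (ha : 0 < a) (hb : 0 < b)
    (hab : Nat.gcd a b = 1) (hA : {i | deg i = a}.Infinite)
    (hB : {i | deg i = -(b : ℤ)}.Infinite) : HasFullSupport (component F deg) := by
  refine Set.eq_univ_of_forall fun g => ?_
  obtain ⟨u, v, -, huv⟩ := exists_combination ha hb hab g
  obtain ⟨l, h1, -, -, h4⟩ := exists_monomial ha hA hB 0 u v
  exact (Submodule.ne_bot_iff _).2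
    ⟨_, Submodule.subset_span ⟨l, h4.trans huv, rfl⟩, prod_gen_ne_zero h1⟩

/-! ## Reduction of the degrees modulo `2` -/

theorem encard_degK_zero (k : ℕ) : {i | degK k i = 0}.encard = k := by
  have : {i | degK k i = 0} = (Finset.range k : Set ℕ) := by
    ext i
    simp [degK]
  rw [this, Set.encard_coe_eq_coe_finsetCard, Finset.card_range]

theorem encard_degK_one (k : ℕ) : {i | degK k i = 1}.encard = ⊤ := by
  rw [Set.encard_eq_top_iff]
  refine (Set.Ici_infinite k).mono fun i hi => ?_
  simpa [degK] using hi

theorem zmod_two_eq_zero_or_one : ∀ g : ZMod 2, g = 0 ∨ g = 1 := by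
  decide

theorem encard_degInf (g : ZMod 2) : {i | degInf i = g}.encard = ⊤ := by
  rw [Set.encard_eq_top_iff]
  obtain rfl | rfl := zmod_two_eq_zero_or_one g
  · refine Set.infinite_of_injective_forall_mem (f := fun n => 2 * n + 1)
      (fun x y h => by simpa using h) fun n => ?_
    simp [degInf, parity_simps]
  · refine Set.infinite_of_injective_forall_mem (f := fun n => 2 * n)
      (fun x y h => by simpa using h) fun n => ?_
    simp [degInf, parity_simps]

/-- Both `a` and `b` are odd, so the generators of even degree are exactly the `k` of degree 0. -/
theorem encard_mod_two_of_odd {deg : ℕ → ℤ} {a b k : ℕ} (hodd : Odd (a * b))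
    (hmem : ∀ i, deg i = -(b : ℤ) ∨ deg i = 0 ∨ deg i = a) (hA : {i | deg i = a}.Infinite)
    (h0 : {i | deg i = 0}.encard = k) (g : ZMod 2) :
    {i | (deg i : ZMod 2) = g}.encard = {i | degK k i = g}.encard := by
  have ha : (a : ZMod 2) = 1 := ZMod.natCast_eq_one_iff_odd.2 (Nat.odd_mul.1 hodd).1
  have hb : (b : ZMod 2) = 1 := ZMod.natCast_eq_one_iff_odd.2 (Nat.odd_mul.1 hodd).2
  obtain rfl | rfl := zmod_two_eq_zero_or_one g
  · refine Eq.trans ?_ (encard_degK_zero k).symm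
    rw [← h0]
    congr 1
    ext i
    rcases hmem i with h | h | h
    · have : b ≠ 0 := by rintro rfl; simp at hb
      simp [h, hb, this]
    · simp [h]
    · have : a ≠ 0 := by rintro rfl; simp at ha
      simp [h, ha, this]
  · refine Eq.trans ?_ (encard_degK_one k).symm
    rw [Set.encard_eq_top_iff]
    refine hA.mono fun i (hi : deg i = a) => ?_
    simp [hi, ha]

/-- By coprimality exactly one of `a`, `b` is even, so both parities occur infinitely often and the
degree-0 generators do not affect the count. -/
theorem encard_mod_two_of_even {deg : ℕ → ℤ} {a b : ℕ} (hab : Nat.gcd a b = 1)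
    (heven : Even (a * b)) (hA : {i | deg i = a}.Infinite)
    (hB : {i | deg i = -(b : ℤ)}.Infinite) (g : ZMod 2) :
    {i | (deg i : ZMod 2) = g}.encard = {i | degInf i = g}.encard := by
  have hA' : ((a : ZMod 2) = g) → {i | (deg i : ZMod 2) = g}.Infinite := fun h =>
    hA.mono fun i (hi : deg i = a) => by simp [hi, h]
  have hB' : ((b : ZMod 2) = g) → {i | (deg i : ZMod 2) = g}.Infinite := fun h =>
    hB.mono fun i (hi : deg i = -(b : ℤ)) => by simp [hi, h]
  rw [encard_degInf, Set.encard_eq_top_iff]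
  have hpar : (a : ZMod 2) = 0 ∧ (b : ZMod 2) = 1 ∨ (a : ZMod 2) = 1 ∧ (b : ZMod 2) = 0 := by
    simp only [ZMod.natCast_eq_zero_iff_even, ZMod.natCast_eq_one_iff_odd, ← Nat.not_even_iff_odd]
    have hno : ¬ (Even a ∧ Even b) := fun h => by
      have := Nat.dvd_gcd h.1.two_dvd h.2.two_dvd
      omega
    have := Nat.even_mul.1 heven
    tauto
  obtain rfl | rfl := zmod_two_eq_zero_or_one g
  · exact hpar.elim (fun h => hA' h.1) (fun h => hB' h.2)
  · exact hpar.elim (fun h => hB' h.2) (fun h => hA' h.1)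

end GrassmannGraded

theorem mainTheorem4 (F : Type u) [Field F] [CharZero F] (a b k : ℕ)
    (ha : 0 < a) (hb : 0 < b) (hk : 0 < k) (hab : Nat.gcd a b = 1)
    (deg : ℕ → ℤ)
    (hdeg : GrassmannGraded.IsInduced ![-(b : ℤ), 0, (a : ℤ)] ![⊤, (k : ℕ∞), ⊤] deg) :
    GrassmannGraded.HasFullSupport (GrassmannGraded.component F deg) ∧
    ∀ τ : ℤ × ℕ → ZMod 2 × ℕ, GrassmannGraded.IsReduction τ →
      (Odd (a * b) →
        GrassmannGraded.gradedIdentities (GrassmannGraded.component F deg) =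
          GrassmannGraded.pullback τ (GrassmannGraded.gradedIdentities
            (GrassmannGraded.component F (GrassmannGraded.degK k))) ∧
        GrassmannGraded.GeneratesVariety (GrassmannGraded.component F deg)
          (GrassmannGraded.pullback τ (GrassmannGraded.gradedIdentities
            (GrassmannGraded.component F (GrassmannGraded.degK k))))) ∧
      (Even (a * b) →
        GrassmannGraded.gradedIdentities (GrassmannGraded.component F deg) =
          GrassmannGraded.pullback τ (GrassmannGraded.gradedIdentities
            (GrassmannGraded.component F GrassmannGraded.degInf)) ∧
        GrassmannGraded.GeneratesVariety (GrassmannGraded.component F deg)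
          (GrassmannGraded.pullback τ (GrassmannGraded.gradedIdentities
            (GrassmannGraded.component F GrassmannGraded.degInf)))) := by
  obtain ⟨-, hmem, hcard⟩ := hdeg
  have hB : {i | deg i = -(b : ℤ)}.Infinite := Set.encard_eq_top_iff.1 (hcard 0)
  have h0 : {i | deg i = 0}.encard = k := hcard 1
  have hA : {i | deg i = a}.Infinite := Set.encard_eq_top_iff.1 (hcard 2)
  have hmem' : ∀ i, deg i = -(b : ℤ) ∨ deg i = 0 ∨ deg i = a := fun i => by
    obtain ⟨j, hj⟩ := hmem i
    fin_cases j
    exacts [Or.inl hj, Or.inr (Or.inl hj), Or.inr (Or.inr hj)]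
  have H := GrassmannGraded.hasEvenMonomials_two_mul ha hb hab hA hB 1
  have H' := GrassmannGraded.hasEvenMonomials_two_mul ha hb hab hA hB (-1)
  refine ⟨GrassmannGraded.hasFullSupport_component ha hb hab hA hB, fun τ hτ => ?_⟩
  have key := GrassmannGraded.gradedIdentities_eq_pullback (F := F) H H' hτ
  have gen := GrassmannGraded.generatesVariety_gradedIdentities (F := F) deg
  refine ⟨fun hodd => ?_, fun heven => ?_⟩
  · rw [← GrassmannGraded.gradedIdentities_eq_of_encard_eq
      (GrassmannGraded.encard_mod_two_of_odd hodd hmem' hA h0), ← key]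
    exact ⟨rfl, gen⟩
  · rw [← GrassmannGraded.gradedIdentities_eq_of_encard_eq
      (GrassmannGraded.encard_mod_two_of_even hab heven hA hB), ← key]
    exact ⟨rfl, gen⟩
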